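/- **Setting.** For an $n$-qubit Hamiltonian (Hermitian $2^n\times 2^n$ matrix) $H$, let $\lambda=(\lambda_P)_P$, $\lambda_P=\mathrm{tr}(PH)/2^n$, be the vector of its Pauli parameters over the non-identity Pauli operators $P\in\{I,X,Y,Z\}^{\otimes n}\setminus\{I^{\otimes n}\}$, let $\|\lambda\|$ be its Euclidean norm and $\|H\|$ the operator norm, and let $H_0=H-\mathrm{tr}(H)\,\mathbb I/2^n$ be the traceless part of $H$ (so $H_0=H$ for a traceless Hamiltonian). With $|\Omega\rangle=2^{-n/2}\sum_{b\in\{0,1\}^n}|b\rangle|b\rangle$, the pseudo-Choi states of an $n$-qubit operator $A$ with and without reference are the normalized vectors $$|\Psi_{\mathrm{ref}}(A)\rangle\propto (A\otimes \mathbb I)|\Omega\rangle|0\rangle+|\Omega\rangle|1\rangle,\qquad |\Psi(A)\rangle\propto (A\otimes \mathbb I)|\Omega\rangle\quad(A\neq 0).$$ A *preparation attempt* with $n_{\mathrm{anc}}$ ancilla qubits draws a circuit $V_L(e^{-\mathrm iHt_L}\otimes \mathbb I)V_{L-1}\cdots V_1(e^{-\mathrm iHt_1}\otimes \mathbb I)V_0$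 with forward times $t_j\ge 0$ from a finite probability distribution, runs it on the all-zeros state of the $n$ system qubits and the $n_{\mathrm{anc}}$ ancillas, and measures some of the ancillas (the flag qubits). It succeeds if all flags are $0$, and its output is then the conditional state of the remaining qubits. The distribution, the unitary control operations $V_j$ and the times $t_j$ may depend on $n,\Delta,\epsilon$ but not on $H$. The evolution time of a circuit is $\sum_j t_j$. For $K=\lceil\log_2(\Delta/\epsilon)\rceil$ put $$\Lambda=\Lambda(\Delta/\epsilon)=\sum_{k=1}^{K}\frac1k+\sum_{j=1}^{K}\frac1j\binom Kj .$$ **Theorem (pseudo-Choi state preparation with uncontrolled time-forward queries).** There are universal constants $C,c>0$ and $p\in\mathbb N$ such that for all $n$ and all $0<\epsilon<\Delta$ the following holds. First, $\Lambda\le C\,\Delta/\epsilon$. Second, there are two preparation attempts, one for each of the following states, such that for every $n$-qubit Hamiltonian $H$ with $2\|H\|\le\Delta$: 1. (with reference) the first succeeds with probability at least $1/2$, and its output is within trace distance $C\epsilon/\Delta$ of $|\Psi_{\mathrm{ref}}(H_0/(\Lambda\Delta))\rangle$; 2. (without reference) the second succeeds with probability at least $c\,\epsilon^2\|\lambda/\Delta^2\|^2$,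 and, if $H_0\ne0$, its output is within trace distance $C\epsilon/\Delta$ of $|\Psi(H_0)\rangle$. In both attempts every circuit has total evolution time at most $\frac{C}{\Delta}\bigl(1+\log(\Delta/\epsilon)\bigr)^2$ and time resolution $t_j\ge \dfrac{c\,\epsilon/\Delta^2}{(1+\log(\Delta/\epsilon))^p}$ for all $j$ (that is, $\widetilde\Omega(\epsilon/\Delta^2)$), and the number of ancillas is at most $n+C\bigl(1+\log(1+\log(\Delta/\epsilon))\bigr)$. -/

import Mathlib

open scoped Kronecker

noncomputable section

namespace PseudoChoi

/-! ### Qubit registers, vectors and operators -/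

/-- Computational basis labels of a register of `k` qubits. -/
abbrev Bits (k : ℕ) : Type := Fin k → Fin 2

/-- Operator norm of a complex matrix with respect to the Euclidean norm. -/
def opNorm {ι : Type} [Fintype ι] [DecidableEq ι] (A : Matrix ι ι ℂ) : ℝ :=
  ‖Matrix.toEuclideanCLM (n := ι) (𝕜 := ℂ) A‖

/-- Schatten 1-norm: the sum of the singular values. -/
def traceNorm {ι : Type} [Fintype ι] [DecidableEq ι] (A : Matrix ι ι ℂ) : ℝ :=
  (Matrix.toEuclideanLin A).singularValues.sum fun _ s => s

/-- Trace distance of two (density) matrices. -/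
def traceDist {ι : Type} [Fintype ι] [DecidableEq ι] (ρ σ : Matrix ι ι ℂ) : ℝ :=
  traceNorm (ρ - σ) / 2

/-- Euclidean norm of a vector of amplitudes. -/
def vecNorm {ι : Type} [Fintype ι] (v : ι → ℂ) : ℝ := ‖WithLp.toLp 2 v‖

/-- The vector `v / ‖v‖`. -/
def normalize {ι : Type} [Fintype ι] (v : ι → ℂ) : ι → ℂ := ((vecNorm v)⁻¹ : ℝ) • v

/-- The rank-one operator `|v⟩⟨v|`. -/
def ketbra {ι : Type} (v : ι → ℂ) : Matrix ι ι ℂ := Matrix.vecMulVec v (star v)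

/-! ### Pauli operators and the parameters of a Hamiltonian -/

/-- The one-qubit Pauli matrices `I, X, Y, Z`. -/
def pauli : Fin 4 → Matrix (Fin 2) (Fin 2) ℂ :=
  ![!![1, 0; 0, 1], !![0, 1; 1, 0], !![0, -Complex.I; Complex.I, 0], !![1, 0; 0, -1]]

/-- The `n`-qubit Pauli operator `P 0 ⊗ ⋯ ⊗ P (n - 1)`. -/
def pauliString {n : ℕ} (P : Fin n → Fin 4) : Matrix (Bits n) (Bits n) ℂ :=
  Matrix.of fun b b' => ∏ i, pauli (P i) (b i) (b' i)

/-- The parameters `λ_P = tr (P H) / 2 ^ n` of an operator, for the non-identity Pauli operators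
`P`, as a vector with the Euclidean norm. -/
def pauliParams {n : ℕ} (H : Matrix (Bits n) (Bits n) ℂ) :
    EuclideanSpace ℂ {P : Fin n → Fin 4 // P ≠ 0} :=
  WithLp.toLp 2 fun P => (pauliString P.1 * H).trace / 2 ^ n

/-- The traceless part `H - (tr H / 2 ^ n) I`. -/
def tracelessPart {n : ℕ} (H : Matrix (Bits n) (Bits n) ℂ) : Matrix (Bits n) (Bits n) ℂ :=
  H - (H.trace / 2 ^ n) • (1 : Matrix (Bits n) (Bits n) ℂ)

/-! ### Pseudo-Choi states -/

/-- The maximally entangled state `|Ω⟩` of two `n`-qubit registers. -/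
def omega (n : ℕ) : Bits n × Bits n → ℂ :=
  fun x => if x.1 = x.2 then ((1 / Real.sqrt (2 ^ n) : ℝ) : ℂ) else 0

/-- The vector `(A ⊗ I)|Ω⟩`. -/
def choiVec {n : ℕ} (A : Matrix (Bits n) (Bits n) ℂ) : Bits n × Bits n → ℂ :=
  Matrix.mulVec (A ⊗ₖ (1 : Matrix (Bits n) (Bits n) ℂ)) (omega n)

/-- The referenceless pseudo-Choi state (meaningful for `A ≠ 0`). -/
def psi {n : ℕ} (A : Matrix (Bits n) (Bits n) ℂ) : Bits n × Bits n → ℂ :=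
  normalize (choiVec A)

/-- The pseudo-Choi state with reference: `(A ⊗ I)|Ω⟩|0⟩ + |Ω⟩|1⟩`, normalized. The second
register holds the second half of `|Ω⟩` followed by the reference qubit. -/
def psiRef {n : ℕ} (A : Matrix (Bits n) (Bits n) ℂ) : Bits n × Bits (n + 1) → ℂ :=
  normalize fun x =>
    if x.2 (Fin.last n) = 0 then choiVec A (x.1, fun i => x.2 i.castSucc)
    else omega n (x.1, fun i => x.2 i.castSucc)

/-! ### Discrete quantum control with forward time evolution

The system has `n` qubits. The ancilla register consists of `k` qubits that are kept as part of the
output and of `q` flag qubits that are measured at the end. -/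

/-- Basis labels of the whole register. -/
abbrev Reg (n k q : ℕ) : Type := Bits n × (Bits k × Bits q)

/-- The time evolution `exp (-i H t)`. -/
def evolution {n : ℕ} (H : Matrix (Bits n) (Bits n) ℂ) (t : ℝ) : Matrix (Bits n) (Bits n) ℂ :=
  NormedSpace.exp ((-(Complex.I * (t : ℂ))) • H)

/-- One query to the unknown evolution, for a time `t ≥ 0`, followed by a control operation on the
system and the ancillas. -/
structure Step (n k q : ℕ) where
  time : ℝ
  time_nonneg : 0 ≤ time
  gate : Matrix.unitaryGroup (Reg n k q) ℂ

/-- A circuit `V_L (exp (-i H t_L) ⊗ I) V_{L-1} ⋯ V_1 (exp (-i H t_1) ⊗ I) V_0`: the control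
operation `V_0` and the list of the steps `(t_1, V_1), …, (t_L, V_L)`. -/
structure Circuit (n k q : ℕ) where
  initial : Matrix.unitaryGroup (Reg n k q) ℂ
  steps : List (Step n k q)

namespace Circuit

variable {n k q : ℕ}

/-- The operator that the circuit implements when the unknown Hamiltonian is `H`. -/
def run (c : Circuit n k q) (H : Matrix (Bits n) (Bits n) ℂ) :
    Matrix (Reg n k q) (Reg n k q) ℂ :=
  c.steps.foldl
    (fun W s => (s.gate : Matrix (Reg n k q) (Reg n k q) ℂ) *
      ((evolution H s.time ⊗ₖ (1 : Matrix (Bits k × Bits q) (Bits k × Bits q) ℂ)) * W))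
    (c.initial : Matrix (Reg n k q) (Reg n k q) ℂ)

/-- Total evolution time. -/
def totalTime (c : Circuit n k q) : ℝ := (c.steps.map Step.time).sum

/-- The subnormalized state of the system and of the kept ancillas, after running the circuit on
the all-zeros state and projecting the flag qubits onto the all-zeros outcome. -/
def flagged (c : Circuit n k q) (H : Matrix (Bits n) (Bits n) ℂ) : Bits n × Bits k → ℂ :=
  fun x => Matrix.mulVec (c.run H) (Pi.single ((0, (0, 0)) : Reg n k q) 1) (x.1, (x.2, 0))

end Circuit

/-- A preparation attempt: a circuit drawn from a finite probability distribution. -/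
structure Protocol (n k q : ℕ) where
  branches : ℕ
  prob : Fin branches → ℝ
  prob_nonneg : ∀ i, 0 ≤ prob i
  prob_sum : ∑ i, prob i = 1
  circuit : Fin branches → Circuit n k q

namespace Protocol

variable {n k q : ℕ}

/-- Number of ancilla qubits. -/
def numAncilla (_A : Protocol n k q) : ℕ := k + q

/-- Every circuit of the protocol has total evolution time at most `T`. -/
def TotalTimeLE (A : Protocol n k q) (T : ℝ) : Prop :=
  ∀ i, (A.circuit i).totalTime ≤ T

/-- Every query of every circuit of the protocol evolves for a time at least `τ`. -/
def ResolutionGE (A : Protocol n k q) (τ : ℝ) : Prop :=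
  ∀ i, ∀ s ∈ (A.circuit i).steps, τ ≤ s.time

/-- The unnormalized output state on success (all flag qubits are measured to be `0`). -/
def successState (A : Protocol n k q) (H : Matrix (Bits n) (Bits n) ℂ) :
    Matrix (Bits n × Bits k) (Bits n × Bits k) ℂ :=
  ∑ i, A.prob i • ketbra ((A.circuit i).flagged H)

/-- The success probability. -/
def successProb (A : Protocol n k q) (H : Matrix (Bits n) (Bits n) ℂ) : ℝ :=
  (A.successState H).trace.re

/-- The output state conditioned on success (meaningful for a positive success probability). -/
def output (A : Protocol n k q) (H : Matrix (Bits n) (Bits n) ℂ) :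
    Matrix (Bits n × Bits k) (Bits n × Bits k) ℂ :=
  (A.successProb H)⁻¹ • A.successState H

end Protocol

/-! ### The scale parameter -/

/-- Coefficients of `∑_{k=1}^K (-1)^(k+1) (U - 1)^k / k = ∑_{j=0}^K c_j U^j`. -/
def logCoeff (K j : ℕ) : ℝ :=
  if j = 0 then -∑ k ∈ Finset.Icc 1 K, (1 / (k : ℝ))
  else (-1) ^ (j + 1) / (j : ℝ) * (K.choose j : ℝ)

/-- The truncation order `⌈log₂ (Δ / ε)⌉`. -/
def truncOrder (Δ ε : ℝ) : ℕ := ⌈Real.logb 2 (Δ / ε)⌉₊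

/-- The parameter `Λ = ∑_{j=0}^K |c_j|` at the truncation order `K = ⌈log₂ (Δ / ε)⌉`. -/
def scale (Δ ε : ℝ) : ℝ :=
  ∑ j ∈ Finset.range (truncOrder Δ ε + 1), |logCoeff (truncOrder Δ ε) j|

end PseudoChoi

end

noncomputable section

/-! Both preparation attempts query the evolution once, for a time of order `1 / (Λ Δ)` and
`ε / Δ ^ 2` respectively, on one half of `|Ω⟩`. The trace of `H` only contributes a global phase, and
`exp (-i H₀ t) = 1 - i t H₀ + Q H₀` with `‖Q‖ ≤ t ^ 2 ‖H₀‖`. The component along `|Ω⟩` is then moved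
to the other value of an ancilla qubit, which is the reference or the flag. The second-order error
is small enough with reference because `Δ / ε ≤ 2 Λ ^ 2`. -/

namespace PseudoChoi

/-! Up to a global phase, one query on half of `|Ω⟩` gives `|Ω⟩ - i t (H₀ ⊗ I)|Ω⟩ + O(t²)`. Under `A
↦ (A ⊗ I)|Ω⟩` the inner product of vectors is the normalized Hilbert–Schmidt product, so traceless
operators are exactly those sent to the complement of `|Ω⟩`. Hence a fixed unitary (`separator`) can
tell the two leading terms apart: it moves the `|Ω⟩` component to the other value of a qubit and
turns `-i t` into `t`.

With the qubit kept as reference, `t = 1 / (Λ Δ)` gives the target state with error of order `(t ·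
2‖H‖)² ≤ 1 / Λ²`. This is at most `2 ε / Δ` because `Λ ≥ 2^K / K` and `K² ≤ 2 · 2^K`
(`div_le_two_mul_scale_sq`). Only the size of `Λ` matters; the logarithm series behind its
coefficients is never implemented.

With the qubit as flag, the success amplitude is itself about `t` times the norm of `choiVec H₀`, so
the error must be small relative to that norm, which can be far below the operator norm. For this
the remainder is written `Q H₀`, with `H₀` as right factor (`exists_exp_eq_one_add_add_mul`), and
bounded by `vecNorm_choiVec_mul_le`: the relative error is `t‖H₀‖`. Bessel's inequality for Pauli
strings then turns the amplitude into a bound by `‖λ‖`. -/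

lemma ketbra_smul {ι : Type} (c : ℂ) (v : ι → ℂ) :
    ketbra (c • v) = (((‖c‖ ^ 2 : ℝ)) : ℂ) • ketbra v := by
  ext i j
  have : (((‖c‖ ^ 2 : ℝ)) : ℂ) = c * star c := by
    rw [Complex.star_def, Complex.mul_conj, Complex.normSq_eq_norm_sq]
  simp only [ketbra, Matrix.vecMulVec_apply, Matrix.smul_apply, Pi.smul_apply, Pi.star_apply, this,
    smul_eq_mul, star_mul']
  ring

lemma ketbra_smul_of_norm_eq_one {ι : Type} {c : ℂ} (hc : ‖c‖ = 1) (v : ι → ℂ) :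
    ketbra (c • v) = ketbra v := by
  rw [ketbra_smul, hc]
  simp

/-! ### Norms and normalization of vectors. -/

section Vectors

variable {ι : Type} [Fintype ι]

lemma vecNorm_nonneg (v : ι → ℂ) : 0 ≤ vecNorm v := norm_nonneg _

lemma vecNorm_smul (c : ℂ) (v : ι → ℂ) : vecNorm (c • v) = ‖c‖ * vecNorm v := by
  simp [vecNorm, WithLp.toLp_smul, norm_smul]

lemma vecNorm_add_le (v w : ι → ℂ) : vecNorm (v + w) ≤ vecNorm v + vecNorm w := by
  simpa [vecNorm, WithLp.toLp_add] using norm_add_le (WithLp.toLp 2 v) (WithLp.toLp 2 w)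

lemma vecNorm_sub_comm (v w : ι → ℂ) : vecNorm (v - w) = vecNorm (w - v) := by
  simpa [vecNorm, WithLp.toLp_sub] using norm_sub_rev (WithLp.toLp 2 v) (WithLp.toLp 2 w)

lemma abs_vecNorm_sub_vecNorm_le (v w : ι → ℂ) : |vecNorm v - vecNorm w| ≤ vecNorm (v - w) := by
  simpa [vecNorm, WithLp.toLp_sub] using abs_norm_sub_norm_le (WithLp.toLp 2 v) (WithLp.toLp 2 w)

lemma vecNorm_sq (v : ι → ℂ) : vecNorm v ^ 2 = ∑ i, ‖v i‖ ^ 2 := by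
  simp [vecNorm, EuclideanSpace.norm_sq_eq]

lemma vecNorm_eq_zero {v : ι → ℂ} : vecNorm v = 0 ↔ v = 0 := by
  simp [vecNorm]

lemma vecNorm_comp_equiv {κ : Type} [Fintype κ] (e : κ ≃ ι) (v : ι → ℂ) :
    vecNorm (fun x => v (e x)) = vecNorm v := by
  rw [← sq_eq_sq₀ (vecNorm_nonneg _) (vecNorm_nonneg _), vecNorm_sq, vecNorm_sq]
  exact e.sum_comp fun i => ‖v i‖ ^ 2

lemma vecNorm_normalize_le (v : ι → ℂ) : vecNorm (normalize v) ≤ 1 := by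
  have : normalize v = (((vecNorm v)⁻¹ : ℝ) : ℂ) • v := rfl
  rw [this, vecNorm_smul, Complex.norm_real, norm_inv, Real.norm_of_nonneg (vecNorm_nonneg v)]
  exact inv_mul_le_one

/-- Rescaling both vectors by `1 / ‖v‖` costs `‖v - w‖ / ‖v‖`, and correcting the length of `w`
costs at most the same again. The case `w = 0` is included, since then `normalize w = 0`. -/
lemma vecNorm_normalize_sub_le (v w : ι → ℂ) (hv : 0 < vecNorm v) :
    vecNorm (normalize v - normalize w) ≤ 2 * vecNorm (v - w) / vecNorm v := by
  have key : normalize v - normalize w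
      = (((vecNorm v)⁻¹ : ℝ) : ℂ) • (v - w)
        + (((vecNorm v)⁻¹ * (vecNorm w - vecNorm v) : ℝ) : ℂ) • normalize w := by
    ext i
    simp only [normalize, Pi.sub_apply, Pi.add_apply, Pi.smul_apply, Complex.real_smul, smul_eq_mul]
    rcases eq_or_ne (vecNorm w) 0 with hw | hw
    · have : w = 0 := vecNorm_eq_zero.1 hw
      simp [this]
    · have hv' : (vecNorm v : ℂ) ≠ 0 := by exact_mod_cast hv.ne'
      have hw' : (vecNorm w : ℂ) ≠ 0 := by exact_mod_cast hw
      push_cast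
      field_simp
      ring
  rw [key]
  refine (vecNorm_add_le _ _).trans ?_
  rw [vecNorm_smul, vecNorm_smul, Complex.norm_real, Complex.norm_real, norm_mul, norm_inv,
    Real.norm_of_nonneg hv.le, Real.norm_eq_abs, abs_sub_comm]
  have h1 := abs_vecNorm_sub_vecNorm_le v w
  have h2 := vecNorm_normalize_le w
  have h3 : 0 ≤ (vecNorm v)⁻¹ * vecNorm (v - w) :=
    mul_nonneg (inv_nonneg.2 hv.le) (vecNorm_nonneg _)
  have h4 := vecNorm_nonneg (normalize w)
  calc _ ≤ (vecNorm v)⁻¹ * vecNorm (v - w) + (vecNorm v)⁻¹ * vecNorm (v - w) * 1 := by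
        gcongr
    _ = _ := by field_simp; ring

lemma normalize_smul_of_norm_eq_one {c : ℂ} (hc : ‖c‖ = 1) (v : ι → ℂ) :
    normalize (c • v) = c • normalize v := by
  ext i
  simp only [normalize, vecNorm_smul, hc, one_mul, Pi.smul_apply, Complex.real_smul, smul_eq_mul]
  ring

lemma normalize_smul_of_pos {r : ℝ} (hr : 0 < r) (v : ι → ℂ) :
    normalize ((r : ℂ) • v) = normalize v := by
  have hr' : (r : ℂ) ≠ 0 := by exact_mod_cast hr.ne'
  ext i
  simp only [normalize, vecNorm_smul, Complex.norm_real, Real.norm_of_nonneg hr.le, Pi.smul_apply,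
    Complex.real_smul, smul_eq_mul, mul_inv]
  push_cast
  field_simp

lemma trace_ketbra (v : ι → ℂ) : (ketbra v).trace = ((vecNorm v ^ 2 : ℝ) : ℂ) := by
  rw [vecNorm_sq]
  simp [ketbra, Matrix.trace, Matrix.vecMulVec_apply, Complex.mul_conj, Complex.normSq_eq_norm_sq]

lemma inv_sq_smul_ketbra (v : ι → ℂ) : (vecNorm v ^ 2)⁻¹ • ketbra v = ketbra (normalize v) := by
  have : normalize v = (((vecNorm v)⁻¹ : ℝ) : ℂ) • v := rfl
  rw [this, ketbra_smul, Complex.norm_real, Real.norm_eq_abs, sq_abs, inv_pow]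
  rfl

end Vectors

/-! ### Operator norm, trace distance of pure states, exponential remainder. -/

section Operators

variable {ι : Type} [Fintype ι] [DecidableEq ι]

lemma opNorm_nonneg (A : Matrix ι ι ℂ) : 0 ≤ opNorm A := norm_nonneg _

lemma opNorm_smul (c : ℂ) (A : Matrix ι ι ℂ) : opNorm (c • A) = ‖c‖ * opNorm A := by
  simp [opNorm, map_smul, norm_smul]

lemma opNorm_sub_le (A B : Matrix ι ι ℂ) : opNorm (A - B) ≤ opNorm A + opNorm B := by
  simpa [opNorm] using norm_sub_le (Matrix.toEuclideanCLM (n := ι) (𝕜 := ℂ) A)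
    (Matrix.toEuclideanCLM (n := ι) (𝕜 := ℂ) B)

lemma opNorm_one_le : opNorm (1 : Matrix ι ι ℂ) ≤ 1 := by
  rw [opNorm, map_one]
  exact ContinuousLinearMap.norm_id_le

lemma vecNorm_mulVec_le (A : Matrix ι ι ℂ) (v : ι → ℂ) :
    vecNorm (A.mulVec v) ≤ opNorm A * vecNorm v :=
  (Matrix.toEuclideanCLM (n := ι) (𝕜 := ℂ) A).le_opNorm (WithLp.toLp 2 v)

/-- The square of a singular value `σ` is an eigenvalue of `T* T`, and an eigenvector `v` satisfies
`‖T v‖ = σ ‖v‖`. -/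
lemma singularValues_le {E : Type*} [NormedAddCommGroup E] [InnerProductSpace ℂ E]
    [FiniteDimensional ℂ E] (T : E →ₗ[ℂ] E) {M : ℝ} (hM : 0 ≤ M) (h : ∀ x, ‖T x‖ ≤ M * ‖x‖)
    (i : ℕ) : T.singularValues i ≤ M := by
  rcases lt_or_ge i (Module.finrank ℂ E) with hi | hi
  · obtain ⟨v, hv⟩ := (T.hasEigenvalue_adjoint_comp_self_sq_singularValues hi).exists_hasEigenvector
    have hv0 : 0 < ‖v‖ := norm_pos_iff.2 hv.2
    have h1 := hv.apply_eq_smul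
    have h2 : ((‖T v‖ ^ 2 : ℝ) : ℂ) = ((T.singularValues i ^ 2 * ‖v‖ ^ 2 : ℝ) : ℂ) := by
      have h3 : inner ℂ v ((LinearMap.adjoint T ∘ₗ T) v) = inner ℂ (T v) (T v) := by
        rw [LinearMap.comp_apply, LinearMap.adjoint_inner_right]
      rw [h1, inner_smul_right, inner_self_eq_norm_sq_to_K, inner_self_eq_norm_sq_to_K] at h3
      push_cast
      simpa using h3.symm
    have h4 : ‖T v‖ ^ 2 = T.singularValues i ^ 2 * ‖v‖ ^ 2 := by exact_mod_cast h2
    have h5 : (T.singularValues i * ‖v‖) ^ 2 ≤ (M * ‖v‖) ^ 2 := by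
      rw [mul_pow, ← h4]
      exact pow_le_pow_left₀ (norm_nonneg _) (h v) 2
    have h6 := (sq_le_sq₀ (mul_nonneg (T.singularValues_nonneg i) hv0.le)
      (mul_nonneg hM hv0.le)).1 h5
    exact le_of_mul_le_mul_right h6 hv0
  -- Singular values are indexed by all naturals and vanish from the dimension on.
  · rw [T.singularValues_of_finrank_le hi]
    exact hM

/-- The rank counts the nonzero singular values, each at most the operator norm. -/
lemma traceNorm_le_rank_mul_opNorm (A : Matrix ι ι ℂ) : traceNorm A ≤ A.rank * opNorm A := by
  unfold traceNorm
  rw [Finsupp.sum]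
  refine (Finset.sum_le_card_nsmul _ _ (opNorm A) fun i _ => ?_).trans ?_
  · exact singularValues_le _ (opNorm_nonneg A)
      (fun x => vecNorm_mulVec_le A (WithLp.ofLp x)) i
  · rw [LinearMap.card_support_singularValues, nsmul_eq_mul, Matrix.rank_eq_finrank_range_toLin A
      (EuclideanSpace.basisFun ι ℂ).toBasis (EuclideanSpace.basisFun ι ℂ).toBasis,
      ← Matrix.toEuclideanLin_eq_toLin_orthonormal]

lemma opNorm_vecMulVec_star_le (a b : ι → ℂ) :
    opNorm (Matrix.vecMulVec a (star b)) ≤ vecNorm a * vecNorm b := by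
  refine ContinuousLinearMap.opNorm_le_bound _ (mul_nonneg (vecNorm_nonneg _) (vecNorm_nonneg _))
    fun x => ?_
  have h : Matrix.toEuclideanCLM (n := ι) (𝕜 := ℂ) (Matrix.vecMulVec a (star b)) x
      = (inner ℂ (WithLp.toLp 2 b) x) • WithLp.toLp 2 a := by
    ext i
    simp [Matrix.mulVec, dotProduct, Matrix.vecMulVec_apply, PiLp.inner_apply,
      mul_comm, mul_left_comm, Finset.mul_sum]
  rw [h, norm_smul, mul_comm, mul_assoc]
  exact mul_le_mul_of_nonneg_left (norm_inner_le_norm _ _) (norm_nonneg _)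

/-- The difference of two rank-one operators has rank at most 2, so its trace norm is controlled by
its operator norm without any dimension factor. -/
lemma traceDist_ketbra_le {a b : ι → ℂ} (ha : vecNorm a ≤ 1) (hb : vecNorm b ≤ 1) :
    traceDist (ketbra a) (ketbra b) ≤ 2 * vecNorm (a - b) := by
  have hop : opNorm (ketbra a - ketbra b) ≤ 2 * vecNorm (a - b) := by
    have h : ketbra a - ketbra b
        = Matrix.vecMulVec a (star (a - b)) - Matrix.vecMulVec (b - a) (star b) := by
      ext i j
      simp only [ketbra, Matrix.sub_apply, Matrix.vecMulVec_apply, Pi.star_apply, Pi.sub_apply,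
        star_sub]
      ring
    rw [h]
    refine (opNorm_sub_le _ _).trans ?_
    have h1 := opNorm_vecMulVec_star_le a (a - b)
    have h2 := opNorm_vecMulVec_star_le (b - a) b
    rw [vecNorm_sub_comm b a] at h2
    have h3 := vecNorm_nonneg (a - b)
    nlinarith
  have hrank : (ketbra a - ketbra b).rank ≤ 2 := by
    -- Factorization through a two-dimensional space.
    have h : ketbra a - ketbra b = (Matrix.of fun (i : ι) (j : Fin 2) => ![a i, -b i] j) *
        (Matrix.of fun (j : Fin 2) (i : ι) => ![star (a i), star (b i)] j) := by
      ext i j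
      simp [ketbra, Matrix.vecMulVec_apply, Matrix.mul_apply, Fin.sum_univ_two, sub_eq_add_neg]
    rw [h]
    exact (Matrix.rank_mul_le_left _ _).trans
      ((Matrix.rank_le_card_width _).trans (Fintype.card_fin 2).le)
  have h := traceNorm_le_rank_mul_opNorm (ketbra a - ketbra b)
  have h5 : ((ketbra a - ketbra b).rank : ℝ) ≤ 2 := by exact_mod_cast hrank
  have h6 := mul_le_mul_of_nonneg_right h5 (opNorm_nonneg (ketbra a - ketbra b))
  unfold traceDist
  linarith

lemma traceDist_ketbra_normalize_le (v w : ι → ℂ) (hv : 0 < vecNorm v) :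
    traceDist (ketbra (normalize v)) (ketbra (normalize w)) ≤ 4 * vecNorm (v - w) / vecNorm v := by
  refine (traceDist_ketbra_le (vecNorm_normalize_le v) (vecNorm_normalize_le w)).trans ?_
  have := vecNorm_normalize_sub_le v w hv
  calc _ ≤ 2 * (2 * vecNorm (v - w) / vecNorm v) := by gcongr
    _ = _ := by ring

/-- Extend `v` to an orthonormal basis and take its members as columns. -/
lemma exists_unitary_mulVec_single (i : ι) {v : ι → ℂ} (hv : vecNorm v = 1) :
    ∃ U : Matrix.unitaryGroup ι ℂ, (U : Matrix ι ι ℂ).mulVec (Pi.single i 1) = v := by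
  have hon : Orthonormal ℂ (({i} : Set ι).domRestrict fun _ => (WithLp.toLp 2 v)) := by
    constructor
    · intro j
      exact hv
    · intro j k hjk
      exact absurd (Subsingleton.elim j k) hjk
  obtain ⟨b, hb⟩ := hon.exists_orthonormalBasis_extension_of_card_eq (by simp)
  refine ⟨⟨_, (EuclideanSpace.basisFun ι ℂ).toMatrix_orthonormalBasis_mem_unitary b⟩, ?_⟩
  ext j
  simp [Module.Basis.toMatrix_apply, hb i rfl]

section Exponential

open scoped Matrix.Norms.L2Operator

/-- Take `Q = ∑ A^(k+1) / (k+2)!`. Since `(k+2)! ≥ 2^(k+1)` and `‖A‖ ≤ 1`, it is dominated by `‖A‖`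
times a geometric series of sum 1. -/
lemma exists_exp_eq_one_add_add_mul (A : Matrix ι ι ℂ) (hA : opNorm A ≤ 1) :
    ∃ Q : Matrix ι ι ℂ, NormedSpace.exp A = 1 + A + Q * A ∧ opNorm Q ≤ opNorm A := by
  have hA' : ‖A‖ ≤ 1 := hA
  set f : ℕ → Matrix ι ι ℂ := fun k => (((k + 2).factorial : ℂ)⁻¹) • A ^ (k + 1) with hf
  have hbound : ∀ k, ‖f k‖ ≤ ‖A‖ * (1 / 2 * (1 / 2) ^ k) := by
    intro k
    have hfac : (2 : ℝ) ^ (k + 1) ≤ ((k + 2).factorial : ℝ) := by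
      have := Nat.factorial_mul_pow_le_factorial (m := 1) (n := k + 1)
      rw [Nat.factorial_one, one_mul, show 1 + (k + 1) = k + 2 by ring] at this
      exact_mod_cast this
    have h1 : ‖A ^ (k + 1)‖ ≤ ‖A‖ := by
      refine (norm_pow_le' A k.succ_pos).trans ?_
      exact pow_le_of_le_one (norm_nonneg _) hA' k.succ_ne_zero
    rw [hf, norm_smul, norm_inv, Complex.norm_natCast, mul_comm]
    have h2 : (1 / 2 * (1 / 2) ^ k : ℝ) = ((2 : ℝ) ^ (k + 1))⁻¹ := by
      rw [← pow_succ', one_div, inv_pow]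
    rw [h2]
    gcongr
  have hgeom : HasSum (fun k : ℕ => ‖A‖ * (1 / 2 * (1 / 2 : ℝ) ^ k)) ‖A‖ := by
    have := ((hasSum_geometric_of_lt_one (r := (1 / 2 : ℝ)) (by norm_num) (by norm_num)).mul_left
      (1 / 2)).mul_left ‖A‖
    convert! this using 1
    norm_num
  have hsum : Summable f := Summable.of_norm_bounded hgeom.summable hbound
  refine ⟨∑' k, f k, ?_, tsum_of_norm_bounded hgeom hbound⟩
  have h1 : HasSum (fun k => f k * A) ((∑' k, f k) * A) := hsum.hasSum.mul_right A
  have h2 : HasSum (fun k => ((k.factorial : ℂ)⁻¹) • A ^ k)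
      ((∑' k, f k) * A + ∑ k ∈ Finset.range 2, ((k.factorial : ℂ)⁻¹) • A ^ k) := by
    rw [← hasSum_nat_add_iff]
    convert! h1 using 1
    ext1 k
    simp only [hf, smul_mul_assoc, ← pow_succ]
  have h3 := NormedSpace.exp_series_hasSum_exp' (𝕂 := ℂ) A
  rw [h3.unique h2]
  simp [Finset.sum_range_succ, add_comm]

end Exponential

end Operators

/-! ### The Choi vector as an isometric picture of operators. -/

section Choi

variable {n : ℕ}

/-- The Choi vector is the matrix itself read as a vector, scaled by `2^(-n/2)`. -/
lemma choiVec_apply (A : Matrix (Bits n) (Bits n) ℂ) (x : Bits n × Bits n) :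
    choiVec A x = A x.1 x.2 * ((1 / Real.sqrt (2 ^ n) : ℝ) : ℂ) := by
  simp [choiVec, omega, Matrix.mulVec, dotProduct, Fintype.sum_prod_type, Matrix.one_apply]

lemma choiVec_add (A B : Matrix (Bits n) (Bits n) ℂ) : choiVec (A + B) = choiVec A + choiVec B := by
  ext x
  simp only [choiVec_apply, Matrix.add_apply, Pi.add_apply, add_mul]

lemma choiVec_smul (c : ℂ) (A : Matrix (Bits n) (Bits n) ℂ) : choiVec (c • A) = c • choiVec A := by
  ext x
  simp only [choiVec_apply, Matrix.smul_apply, Pi.smul_apply, smul_eq_mul, mul_assoc]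

lemma choiVec_one : choiVec (1 : Matrix (Bits n) (Bits n) ℂ) = omega n := by
  ext x
  rw [choiVec_apply]
  simp only [omega, Matrix.one_apply, ite_mul, one_mul, zero_mul]

lemma inv_sqrt_mul_inv_sqrt (n : ℕ) :
    ((1 / Real.sqrt (2 ^ n) : ℝ) : ℂ) * ((1 / Real.sqrt (2 ^ n) : ℝ) : ℂ) = (2 ^ n)⁻¹ := by
  rw [← Complex.ofReal_mul, ← sq, div_pow, Real.sq_sqrt (by positivity)]
  push_cast
  simp

lemma inner_choiVec (A B : Matrix (Bits n) (Bits n) ℂ) :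
    star (choiVec A) ⬝ᵥ choiVec B = (A.conjTranspose * B).trace / 2 ^ n := by
  have h : (A.conjTranspose * B).trace = ∑ x : Bits n × Bits n, star (A x.1 x.2) * B x.1 x.2 := by
    simp only [Matrix.trace, Matrix.diag_apply, Matrix.mul_apply, Matrix.conjTranspose_apply]
    rw [Finset.sum_comm, Fintype.sum_prod_type]
  rw [h, div_eq_mul_inv, ← inv_sqrt_mul_inv_sqrt, Finset.sum_mul]
  refine Finset.sum_congr rfl fun x _ => ?_
  rw [Pi.star_apply, choiVec_apply, choiVec_apply, star_mul', Complex.star_def, Complex.conj_ofReal]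
  ring

lemma inner_omega_choiVec (A : Matrix (Bits n) (Bits n) ℂ) :
    star (omega n) ⬝ᵥ choiVec A = A.trace / 2 ^ n := by
  rw [← choiVec_one, inner_choiVec, Matrix.conjTranspose_one, one_mul]

lemma vecNorm_omega (n : ℕ) : vecNorm (omega n) = 1 := by
  have h := trace_ketbra (omega n)
  have h1 : (ketbra (omega n)).trace = star (omega n) ⬝ᵥ omega n := by
    simp [ketbra, Matrix.trace, Matrix.vecMulVec_apply, dotProduct, mul_comm]
  have h2 : star (omega n) ⬝ᵥ omega n = 1 := by
    have := inner_omega_choiVec (1 : Matrix (Bits n) (Bits n) ℂ)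
    rw [choiVec_one] at this
    rw [this, Matrix.trace_one]
    simp
  rw [h1, h2] at h
  have h3 : vecNorm (omega n) ^ 2 = 1 := by exact_mod_cast h.symm
  exact (pow_eq_one_iff_of_nonneg (vecNorm_nonneg _) two_ne_zero).1 h3

/-- Left multiplication by `Q` acts on each column of `A` separately, so the operator norm bound can
be squared and summed over columns. -/
lemma vecNorm_choiVec_mul_le (Q A : Matrix (Bits n) (Bits n) ℂ) :
    vecNorm (choiVec (Q * A)) ≤ opNorm Q * vecNorm (choiVec A) := by
  rw [← sq_le_sq₀ (vecNorm_nonneg _) (mul_nonneg (opNorm_nonneg _) (vecNorm_nonneg _)), mul_pow,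
    vecNorm_sq, vecNorm_sq, Fintype.sum_prod_type_right, Fintype.sum_prod_type_right,
    Finset.mul_sum]
  refine Finset.sum_le_sum fun y _ => ?_
  have h : (fun x => choiVec (Q * A) (x, y)) = Q.mulVec fun x => choiVec A (x, y) := by
    ext x
    simp only [choiVec_apply, Matrix.mul_apply, Matrix.mulVec, dotProduct, Finset.sum_mul,
      mul_assoc]
  have h1 := vecNorm_mulVec_le Q fun x => choiVec A (x, y)
  rw [← h] at h1
  have h2 := pow_le_pow_left₀ (vecNorm_nonneg _) h1 2
  rwa [mul_pow, vecNorm_sq, vecNorm_sq] at h2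

lemma vecNorm_choiVec_le (A : Matrix (Bits n) (Bits n) ℂ) : vecNorm (choiVec A) ≤ opNorm A := by
  have h := vecNorm_choiVec_mul_le A 1
  rwa [mul_one, choiVec_one, vecNorm_omega, mul_one] at h

lemma tracelessPart_add (A B : Matrix (Bits n) (Bits n) ℂ) :
    tracelessPart (A + B) = tracelessPart A + tracelessPart B := by
  simp only [tracelessPart, Matrix.trace_add, add_div, add_smul]
  abel

lemma tracelessPart_smul (c : ℂ) (A : Matrix (Bits n) (Bits n) ℂ) :
    tracelessPart (c • A) = c • tracelessPart A := by
  simp only [tracelessPart, Matrix.trace_smul, smul_eq_mul, smul_sub, smul_smul, mul_div_assoc]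

lemma tracelessPart_one : tracelessPart (1 : Matrix (Bits n) (Bits n) ℂ) = 0 := by
  simp [tracelessPart]

lemma trace_tracelessPart (A : Matrix (Bits n) (Bits n) ℂ) : (tracelessPart A).trace = 0 := by
  simp [tracelessPart]

lemma tracelessPart_tracelessPart (A : Matrix (Bits n) (Bits n) ℂ) :
    tracelessPart (tracelessPart A) = tracelessPart A := by
  rw [tracelessPart, trace_tracelessPart, zero_div, zero_smul, sub_zero]

lemma eq_smul_one_add_tracelessPart (A : Matrix (Bits n) (Bits n) ℂ) :
    A = (A.trace / 2 ^ n) • (1 : Matrix (Bits n) (Bits n) ℂ) + tracelessPart A := by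
  rw [tracelessPart, add_sub_cancel]

lemma choiVec_tracelessPart (A : Matrix (Bits n) (Bits n) ℂ) :
    choiVec (tracelessPart A) = choiVec A - (A.trace / 2 ^ n) • omega n := by
  nth_rw 2 [eq_smul_one_add_tracelessPart A]
  rw [choiVec_add, choiVec_smul, choiVec_one, add_sub_cancel_left]

/-- Pythagoras for the decomposition of an operator into its trace and its traceless part. -/
lemma vecNorm_choiVec_sq (A : Matrix (Bits n) (Bits n) ℂ) :
    vecNorm (choiVec A) ^ 2 = ‖A.trace / 2 ^ n‖ ^ 2 + vecNorm (choiVec (tracelessPart A)) ^ 2 := by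
  have h0 : inner ℂ (WithLp.toLp 2 ((A.trace / 2 ^ n) • omega n))
      (WithLp.toLp 2 (choiVec (tracelessPart A))) = 0 := by
    have h := inner_omega_choiVec (tracelessPart A)
    rw [trace_tracelessPart, zero_div] at h
    rw [WithLp.toLp_smul, inner_smul_left, EuclideanSpace.inner_toLp_toLp, dotProduct_comm, h,
      mul_zero]
  have h1 := norm_add_sq_eq_norm_sq_add_norm_sq_of_inner_eq_zero _ _ h0
  have h2 : choiVec A = (A.trace / 2 ^ n) • omega n + choiVec (tracelessPart A) := by
    rw [choiVec_tracelessPart, add_sub_cancel]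
  have h3 : vecNorm ((A.trace / 2 ^ n) • omega n) = ‖A.trace / 2 ^ n‖ := by
    rw [vecNorm_smul, vecNorm_omega, mul_one]
  rw [← h3]
  nth_rw 1 [h2]
  simp only [sq]
  exact h1

lemma vecNorm_choiVec_tracelessPart_le (A : Matrix (Bits n) (Bits n) ℂ) :
    vecNorm (choiVec (tracelessPart A)) ≤ vecNorm (choiVec A) := by
  rw [← sq_le_sq₀ (vecNorm_nonneg _) (vecNorm_nonneg _), vecNorm_choiVec_sq A]
  exact le_add_of_nonneg_left (sq_nonneg _)

lemma norm_trace_div_le (A : Matrix (Bits n) (Bits n) ℂ) : ‖A.trace / 2 ^ n‖ ≤ opNorm A := by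
  refine le_trans ?_ (vecNorm_choiVec_le A)
  rw [← sq_le_sq₀ (norm_nonneg _) (vecNorm_nonneg _), vecNorm_choiVec_sq A]
  exact le_add_of_nonneg_right (sq_nonneg _)

lemma opNorm_tracelessPart_le (A : Matrix (Bits n) (Bits n) ℂ) :
    opNorm (tracelessPart A) ≤ 2 * opNorm A := by
  refine (opNorm_sub_le _ _).trans ?_
  rw [opNorm_smul]
  have h1 := norm_trace_div_le A
  have h2 := opNorm_one_le (ι := Bits n)
  have h3 := norm_nonneg (A.trace / 2 ^ n)
  nlinarith

end Choi

/-! ### Orthonormality of the Pauli strings. -/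

section Pauli

variable {n : ℕ}

lemma pauliString_zero : pauliString (0 : Fin n → Fin 4) = 1 := by
  have h : pauli 0 = 1 := by
    ext i j
    fin_cases i <;> fin_cases j <;> simp [pauli]
  ext b b'
  simp only [pauliString, Matrix.of_apply, Pi.zero_apply, h, Matrix.one_apply]
  by_cases hb : b = b'
  · simp [hb]
  · obtain ⟨i, hi⟩ := Function.ne_iff.1 hb
    rw [if_neg hb]
    exact Finset.prod_eq_zero (Finset.mem_univ i) (if_neg hi)

lemma conjTranspose_pauli (a : Fin 4) : (pauli a).conjTranspose = pauli a := by
  ext i j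
  fin_cases a <;> fin_cases i <;> fin_cases j <;> simp [pauli]

lemma conjTranspose_pauliString (P : Fin n → Fin 4) :
    (pauliString P).conjTranspose = pauliString P := by
  ext b b'
  simp only [pauliString, Matrix.conjTranspose_apply, Matrix.of_apply, star_prod]
  refine Finset.prod_congr rfl fun i _ => ?_
  rw [← Matrix.conjTranspose_apply, conjTranspose_pauli]

lemma trace_pauli_mul_pauli (a b : Fin 4) :
    (pauli a * pauli b).trace = if a = b then 2 else 0 := by
  fin_cases a <;> fin_cases b <;>
    simp [pauli, Matrix.trace, Fin.sum_univ_two] <;> norm_num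

/-- The trace of a product of tensor products factors over the qubits. -/
lemma trace_pauliString_mul_pauliString (P Q : Fin n → Fin 4) :
    (pauliString P * pauliString Q).trace = if P = Q then 2 ^ n else 0 := by
  have h : (pauliString P * pauliString Q).trace = ∏ i, (pauli (P i) * pauli (Q i)).trace := by
    simp only [Matrix.trace, Matrix.diag_apply, Matrix.mul_apply, pauliString, Matrix.of_apply,
      ← Finset.prod_mul_distrib]
    rw [Fintype.prod_sum]
    refine Finset.sum_congr rfl fun b _ => ?_
    rw [Fintype.prod_sum]
  rw [h]
  simp only [trace_pauli_mul_pauli]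
  by_cases hPQ : P = Q
  · simp [hPQ]
  · obtain ⟨i, hi⟩ := Function.ne_iff.1 hPQ
    rw [if_neg hPQ]
    exact Finset.prod_eq_zero (Finset.mem_univ i) (if_neg hi)

lemma orthonormal_choiVec_pauliString :
    Orthonormal ℂ fun P : Fin n → Fin 4 => WithLp.toLp 2 (choiVec (pauliString P)) := by
  classical
  rw [orthonormal_iff_ite]
  intro P Q
  rw [EuclideanSpace.inner_toLp_toLp, dotProduct_comm, inner_choiVec, conjTranspose_pauliString,
    trace_pauliString_mul_pauliString]
  split_ifs <;> simp

/-- Bessel's inequality for the Pauli parameters. -/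
lemma norm_pauliParams_le (A : Matrix (Bits n) (Bits n) ℂ) :
    ‖pauliParams A‖ ≤ vecNorm (choiVec (tracelessPart A)) := by
  have hon : Orthonormal ℂ fun P : {P : Fin n → Fin 4 // P ≠ 0} =>
      WithLp.toLp 2 (choiVec (pauliString P.1)) :=
    orthonormal_choiVec_pauliString.comp _ Subtype.val_injective
  have hB := hon.sum_inner_products_le (WithLp.toLp 2 (choiVec (tracelessPart A)))
    (s := Finset.univ)
  rw [← sq_le_sq₀ (norm_nonneg _) (vecNorm_nonneg _), EuclideanSpace.norm_sq_eq]
  refine le_trans (le_of_eq (Finset.sum_congr rfl fun P _ => ?_)) hB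
  -- Removing the trace of `A` does not affect its parameters at non-identity strings.
  have hP : (pauliString P.1).trace = 0 := by
    have := trace_pauliString_mul_pauliString P.1 0
    rwa [pauliString_zero, mul_one, if_neg P.2] at this
  rw [EuclideanSpace.inner_toLp_toLp, dotProduct_comm, inner_choiVec, conjTranspose_pauliString]
  simp [pauliParams, tracelessPart, mul_sub, hP]

end Pauli

/-! ### Global phase and short-time expansion of the evolution. -/

section Evolution

variable {n : ℕ}

/-- The scalar part of `H` commutes with the rest, and Hermiticity makes it real, so its exponential
is a phase. -/
lemma exists_evolution_eq_smul_tracelessPart {H : Matrix (Bits n) (Bits n) ℂ} (hH : H.IsHermitian)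
    (t : ℝ) : ∃ u : ℂ, ‖u‖ = 1 ∧ evolution H t = u • evolution (tracelessPart H) t := by
  obtain ⟨h, hh⟩ : ∃ h : ℝ, H.trace / 2 ^ n = h := by
    have h1 : star H.trace = H.trace := by rw [← Matrix.trace_conjTranspose, hH.eq]
    obtain ⟨r, hr⟩ := Complex.conj_eq_iff_real.1 h1
    exact ⟨r / 2 ^ n, by rw [hr]; push_cast; rfl⟩
  refine ⟨Complex.exp ((-(t * h) : ℝ) * Complex.I), Complex.norm_exp_ofReal_mul_I _, ?_⟩
  have hexp : NormedSpace.exp ((((-(t * h) : ℝ) : ℂ) * Complex.I) • (1 : Matrix (Bits n) (Bits n) ℂ))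
      = Complex.exp ((-(t * h) : ℝ) * Complex.I) • (1 : Matrix (Bits n) (Bits n) ℂ) := by
    rw [Matrix.smul_one_eq_diagonal, Matrix.exp_diagonal, Matrix.smul_one_eq_diagonal]
    congr 1
    ext i
    rw [Pi.coe_exp, Complex.exp_eq_exp_ℂ]
  have hsplit : (-(Complex.I * (t : ℂ))) • H
      = (((-(t * h) : ℝ) : ℂ) * Complex.I) • (1 : Matrix (Bits n) (Bits n) ℂ)
        + (-(Complex.I * (t : ℂ))) • tracelessPart H := by
    nth_rw 1 [eq_smul_one_add_tracelessPart H]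
    rw [hh, smul_add, smul_smul]
    congr 2
    push_cast
    ring
  unfold evolution
  rw [hsplit, Matrix.exp_add_of_commute _ _ ((Commute.one_left _).smul_left _), hexp, smul_mul_assoc,
    one_mul]

/-- First-order expansion of a short time evolution, as seen by the pseudo-Choi vector. -/
lemma exists_evolution_eq_add_remainder (A : Matrix (Bits n) (Bits n) ℂ) {t : ℝ} (ht : 0 ≤ t)
    (hA : t * opNorm A ≤ 1) :
    ∃ R, evolution A t = 1 + (-(Complex.I * (t : ℂ))) • A + R ∧
      vecNorm (choiVec R) ≤ t * opNorm A * (t * vecNorm (choiVec A)) := by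
  have hnorm : ‖-(Complex.I * (t : ℂ))‖ = t := by
    rw [norm_neg, norm_mul, Complex.norm_I, one_mul, Complex.norm_real, Real.norm_of_nonneg ht]
  have hop : opNorm ((-(Complex.I * (t : ℂ))) • A) = t * opNorm A := by rw [opNorm_smul, hnorm]
  obtain ⟨Q, hQ, hQn⟩ := exists_exp_eq_one_add_add_mul _ (hop.trans_le hA)
  refine ⟨_, hQ, (vecNorm_choiVec_mul_le _ _).trans ?_⟩
  rw [choiVec_smul, vecNorm_smul, hnorm]
  rw [hop] at hQn
  exact mul_le_mul_of_nonneg_right hQn (mul_nonneg ht (vecNorm_nonneg _))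

end Evolution

/-! ### The separating unitary and the one-query circuit. -/

section Gate

variable {n k q : ℕ}

lemma ketbra_omega_mul_self (n : ℕ) : ketbra (omega n) * ketbra (omega n) = ketbra (omega n) := by
  have h := inner_omega_choiVec (1 : Matrix (Bits n) (Bits n) ℂ)
  rw [choiVec_one, Matrix.trace_one] at h
  have h' : star (omega n) ⬝ᵥ omega n = 1 := by
    rw [h]
    simp
  rw [ketbra, Matrix.vecMulVec_mul_vecMulVec, h', one_smul]

lemma conjTranspose_ketbra {ι : Type} (v : ι → ℂ) : (ketbra v).conjTranspose = ketbra v := by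
  rw [ketbra, Matrix.conjTranspose_vecMulVec, star_star]

lemma pauli_one_mul_self : pauli 1 * pauli 1 = 1 := by
  ext i j
  fin_cases i <;> fin_cases j <;> simp [pauli]

/-- The operator `|Ω⟩⟨Ω| ⊗ X + i (1 - |Ω⟩⟨Ω|) ⊗ 1`: it flips the last qubit on `|Ω⟩` and applies
the phase `i` on the orthogonal complement of `|Ω⟩`. -/
def separator (n : ℕ) : Matrix ((Bits n × Bits n) × Fin 2) ((Bits n × Bits n) × Fin 2) ℂ :=
  ketbra (omega n) ⊗ₖ pauli 1 + (1 - ketbra (omega n)) ⊗ₖ (Complex.I • (1 : Matrix (Fin 2) (Fin 2) ℂ))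

/-- With `P = |Ω⟩⟨Ω|`, a projection, the operator is block diagonal for `P` and `1 - P`, with the
unitaries `X` and `i` on the blocks. -/
lemma separator_mul_conjTranspose (n : ℕ) : separator n * (separator n).conjTranspose = 1 := by
  have hP := ketbra_omega_mul_self n
  have h1 : ketbra (omega n) * (1 - ketbra (omega n)) = 0 := by rw [mul_sub, mul_one, hP, sub_self]
  have h2 : (1 - ketbra (omega n)) * ketbra (omega n) = 0 := by rw [sub_mul, one_mul, hP, sub_self]
  have h3 : (1 - ketbra (omega n)) * (1 - ketbra (omega n)) = 1 - ketbra (omega n) := by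
    rw [mul_sub, h2, sub_zero, mul_one]
  rw [separator, Matrix.conjTranspose_add, Matrix.conjTranspose_kronecker,
    Matrix.conjTranspose_kronecker, Matrix.conjTranspose_sub, conjTranspose_ketbra,
    conjTranspose_pauli, Matrix.conjTranspose_smul, Matrix.conjTranspose_one,
    Matrix.conjTranspose_one, add_mul, mul_add, mul_add, ← Matrix.mul_kronecker_mul,
    ← Matrix.mul_kronecker_mul, ← Matrix.mul_kronecker_mul, ← Matrix.mul_kronecker_mul, hP, h1, h2,
    h3, pauli_one_mul_self, Matrix.zero_kronecker, Matrix.zero_kronecker, add_zero, zero_add,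
    smul_mul_smul_comm, mul_one, Complex.star_def, Complex.mul_conj, Complex.normSq_I,
    Complex.ofReal_one, one_smul, ← Matrix.add_kronecker, add_sub_cancel, Matrix.one_kronecker_one]

/-- The vector `(A ⊗ 1)|Ω⟩|0⟩`. -/
def choiZero (A : Matrix (Bits n) (Bits n) ℂ) : (Bits n × Bits n) × Fin 2 → ℂ :=
  fun p => if p.2 = 0 then choiVec A p.1 else 0

/-- The component of `choiVec A` along `|Ω⟩` is `tr A / 2^n`, and the rest is the Choi vector of the
traceless part. -/
lemma separator_mulVec_choiZero (A : Matrix (Bits n) (Bits n) ℂ) :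
    (separator n).mulVec (choiZero A) = fun p =>
      if p.2 = 0 then Complex.I * choiVec (tracelessPart A) p.1
      else A.trace / 2 ^ n * omega n p.1 := by
  have hP : (ketbra (omega n)).mulVec (choiVec A) = (A.trace / 2 ^ n) • omega n := by
    ext x
    rw [← inner_omega_choiVec A]
    simp only [ketbra, Matrix.vecMulVec_mulVec, Pi.smul_apply, smul_eq_mul,
      MulOpposite.smul_eq_mul_unop, MulOpposite.unop_op, mul_comm]
  ext ⟨x, f⟩
  have h : (separator n).mulVec (choiZero A) (x, f)
      = pauli 1 f 0 * (ketbra (omega n)).mulVec (choiVec A) x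
        + (Complex.I • (1 : Matrix (Fin 2) (Fin 2) ℂ)) f 0
          * (1 - ketbra (omega n)).mulVec (choiVec A) x := by
    simp only [Matrix.mulVec, dotProduct, separator, choiZero]
    rw [Fintype.sum_prod_type, Finset.mul_sum, Finset.mul_sum, ← Finset.sum_add_distrib]
    refine Finset.sum_congr rfl fun y _ => ?_
    rw [Fin.sum_univ_two, if_pos rfl, if_neg one_ne_zero, mul_zero, add_zero, Matrix.add_apply,
      Matrix.kroneckerMap_apply, Matrix.kroneckerMap_apply]
    ring
  rw [h, Matrix.sub_mulVec, Matrix.one_mulVec, hP, ← choiVec_tracelessPart]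
  fin_cases f <;> simp [pauli]

/-- The identification of the whole register that is induced by splitting the ancilla register into
a copy of the system and one further qubit. -/
def regEquiv (e : Bits k × Bits q ≃ Bits n × Fin 2) : Reg n k q ≃ (Bits n × Bits n) × Fin 2 :=
  ((Equiv.refl _).prodCongr e).trans (Equiv.prodAssoc _ _ _).symm

lemma regEquiv_apply (e : Bits k × Bits q ≃ Bits n × Fin 2) (x : Bits n) (r : Bits k × Bits q) :
    regEquiv e (x, r) = ((x, (e r).1), (e r).2) := rfl

/-- The operator `separator` as a control operation. -/
def separatorGate (e : Bits k × Bits q ≃ Bits n × Fin 2) : Matrix.unitaryGroup (Reg n k q) ℂ :=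
  ⟨(separator n).submatrix (regEquiv e) (regEquiv e), by
    rw [Matrix.mem_unitaryGroup_iff, Matrix.star_eq_conjTranspose, Matrix.conjTranspose_submatrix,
      Matrix.submatrix_mul_equiv, separator_mul_conjTranspose, Matrix.submatrix_one_equiv]⟩

lemma kronecker_one_mulVec_choiZero (e : Bits k × Bits q ≃ Bits n × Fin 2)
    (A : Matrix (Bits n) (Bits n) ℂ) :
    (A ⊗ₖ (1 : Matrix (Bits k × Bits q) (Bits k × Bits q) ℂ)).mulVec
      (choiZero (1 : Matrix (Bits n) (Bits n) ℂ) ∘ regEquiv e) = choiZero A ∘ regEquiv e := by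
  ext ⟨x, r⟩
  simp only [Matrix.mulVec, dotProduct, Function.comp_apply]
  rw [Fintype.sum_prod_type_right, Finset.sum_eq_single r]
  · simp only [Matrix.kroneckerMap_apply, Matrix.one_apply_eq, mul_one, regEquiv_apply, choiZero,
      choiVec_apply]
    split_ifs
    · simp [Matrix.one_apply]
    · simp
  · intro r' _ hr
    simp [Matrix.one_apply_ne hr.symm]
  · simp

lemma vecNorm_choiZero (A : Matrix (Bits n) (Bits n) ℂ) :
    vecNorm (choiZero A) = vecNorm (choiVec A) := by
  rw [← sq_eq_sq₀ (vecNorm_nonneg _) (vecNorm_nonneg _), vecNorm_sq, vecNorm_sq,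
    Fintype.sum_prod_type]
  simp [choiZero, Fin.sum_univ_two]

/-- A circuit with a single query, whose state at the end consists of the traceless part of the
evolution, next to the component of the evolution along `|Ω⟩`. -/
lemma exists_circuit (e : Bits k × Bits q ≃ Bits n × Fin 2) {t : ℝ} (ht : 0 ≤ t) :
    ∃ c : Circuit n k q, c.totalTime = t ∧ (∀ s ∈ c.steps, s.time = t) ∧
      ∀ H x, c.flagged H x =
        if (e (x.2, 0)).2 = 0 then
          Complex.I * choiVec (tracelessPart (evolution H t)) (x.1, (e (x.2, 0)).1)
        else (evolution H t).trace / 2 ^ n * omega n (x.1, (e (x.2, 0)).1) := by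
  have hv : vecNorm (choiZero (1 : Matrix (Bits n) (Bits n) ℂ) ∘ regEquiv e) = 1 := by
    refine (vecNorm_comp_equiv (regEquiv e) _).trans ?_
    rw [vecNorm_choiZero, choiVec_one, vecNorm_omega]
  -- The initial control operation prepares `|Ω⟩|0⟩` from the all-zeros state.
  obtain ⟨U, hU⟩ := exists_unitary_mulVec_single ((0, (0, 0)) : Reg n k q) hv
  refine ⟨⟨U, [⟨t, ht, separatorGate e⟩]⟩, by simp [Circuit.totalTime], by simp, fun H x => ?_⟩
  have h : (separatorGate e : Matrix (Reg n k q) (Reg n k q) ℂ).mulVec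
      (choiZero (evolution H t) ∘ regEquiv e)
      = (separator n).mulVec (choiZero (evolution H t)) ∘ regEquiv e := by
    refine (Matrix.submatrix_mulVec_equiv _ _ _ _).trans ?_
    rw [Function.comp_assoc, Equiv.self_comp_symm, Function.comp_id]
  simp only [Circuit.flagged, Circuit.run, List.foldl_cons, List.foldl_nil]
  rw [← Matrix.mulVec_mulVec, ← Matrix.mulVec_mulVec, hU, kronecker_one_mulVec_choiZero, h,
    separator_mulVec_choiZero, Function.comp_apply, regEquiv_apply]

/-- The preparation attempt that always runs the same circuit. -/
def Protocol.ofCircuit (c : Circuit n k q) : Protocol n k q where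
  branches := 1
  prob _ := 1
  prob_nonneg _ := zero_le_one
  prob_sum := by simp
  circuit _ := c

lemma Protocol.successState_ofCircuit (c : Circuit n k q) (H : Matrix (Bits n) (Bits n) ℂ) :
    (Protocol.ofCircuit c).successState H = ketbra (c.flagged H) := by
  unfold Protocol.successState Protocol.ofCircuit
  rw [Fin.sum_univ_one, one_smul]

lemma Protocol.successProb_ofCircuit (c : Circuit n k q) (H : Matrix (Bits n) (Bits n) ℂ) :
    (Protocol.ofCircuit c).successProb H = vecNorm (c.flagged H) ^ 2 := by
  rw [Protocol.successProb, Protocol.successState_ofCircuit, trace_ketbra, Complex.ofReal_re]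

lemma Protocol.output_ofCircuit (c : Circuit n k q) (H : Matrix (Bits n) (Bits n) ℂ) :
    (Protocol.ofCircuit c).output H = ketbra (normalize (c.flagged H)) := by
  rw [Protocol.output, Protocol.successProb_ofCircuit, Protocol.successState_ofCircuit,
    inv_sq_smul_ketbra]

end Gate

/-! ### Two-sided bounds on `Λ`. -/

section Scale

/-- The factor 2 is there for `K = 3`, where `9 > 8`. -/
lemma sq_le_two_mul_two_pow (K : ℕ) : K ^ 2 ≤ 2 * 2 ^ K := by
  induction K with
  | zero => norm_num
  | succ K ih =>
    rcases le_or_gt K 2 with h | h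
    · interval_cases K <;> norm_num
    · rw [pow_succ 2 K]
      nlinarith

variable {Δ ε : ℝ}

lemma truncOrder_pos (hε : 0 < ε) (h : ε < Δ) : 0 < truncOrder Δ ε :=
  Nat.ceil_pos.2 (Real.logb_pos one_lt_two ((one_lt_div hε).2 h))

lemma div_le_two_pow_truncOrder (hε : 0 < ε) (h : ε < Δ) : Δ / ε ≤ 2 ^ truncOrder Δ ε := by
  have h1 := (Real.logb_le_iff_le_rpow one_lt_two (div_pos (hε.trans h) hε)).1
    (Nat.le_ceil (Real.logb 2 (Δ / ε)))
  rwa [Real.rpow_natCast] at h1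

lemma two_pow_truncOrder_le (hε : 0 < ε) (h : ε < Δ) : 2 ^ truncOrder Δ ε ≤ 2 * (Δ / ε) := by
  have hx : 0 < Δ / ε := div_pos (hε.trans h) hε
  have h1 := (Nat.ceil_lt_add_one (Real.logb_pos one_lt_two ((one_lt_div hε).2 h)).le).le
  have h2 := Real.rpow_le_rpow_of_exponent_le one_le_two h1
  rw [Real.rpow_natCast, Real.rpow_add two_pos, Real.rpow_logb two_pos one_lt_two.ne' hx,
    Real.rpow_one, mul_comm] at h2
  exact h2

lemma abs_logCoeff_zero (K : ℕ) : |logCoeff K 0| = ∑ k ∈ Finset.Icc 1 K, (1 / (k : ℝ)) := by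
  rw [logCoeff, if_pos rfl, abs_neg, abs_of_nonneg]
  exact Finset.sum_nonneg fun k _ => by positivity

lemma abs_logCoeff {K j : ℕ} (hj : j ≠ 0) : |logCoeff K j| = K.choose j / j := by
  rw [logCoeff, if_neg hj, abs_mul, abs_div, abs_pow, abs_neg, abs_one, one_pow, Nat.abs_cast,
    Nat.abs_cast]
  ring

/-- Weakening `1 / j` to `1 / K` makes the bounds summable by the binomial theorem. At `j = 0` the
last harmonic term `1 / K` suffices. -/
lemma choose_div_le_abs_logCoeff {K j : ℕ} (hK : 0 < K) (hj : j ≤ K) :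
    (K.choose j : ℝ) / K ≤ |logCoeff K j| := by
  have hK' : (1 : ℝ) ≤ K := by exact_mod_cast hK
  rcases Nat.eq_zero_or_pos j with rfl | hj0
  · rw [abs_logCoeff_zero, Nat.choose_zero_right, Nat.cast_one]
    exact Finset.single_le_sum (f := fun k : ℕ => 1 / (k : ℝ)) (fun k _ => by positivity)
      (Finset.mem_Icc.2 ⟨hK, le_rfl⟩)
  · rw [abs_logCoeff hj0.ne']
    gcongr

lemma abs_logCoeff_le (K j : ℕ) :
    |logCoeff K j| ≤ K.choose j + if j = 0 then (K : ℝ) else 0 := by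
  rcases Nat.eq_zero_or_pos j with rfl | hj0
  · rw [abs_logCoeff_zero, Nat.choose_zero_right, if_pos rfl]
    have : ∑ k ∈ Finset.Icc 1 K, (1 / (k : ℝ)) ≤ ∑ k ∈ Finset.Icc 1 K, (1 : ℝ) := by
      refine Finset.sum_le_sum fun k hk => ?_
      have : (1 : ℝ) ≤ k := by exact_mod_cast (Finset.mem_Icc.1 hk).1
      exact (div_le_one (by linarith)).2 this
    rw [Finset.sum_const, Nat.card_Icc, Nat.add_sub_cancel, nsmul_eq_mul, mul_one] at this
    push_cast
    linarith
  · rw [abs_logCoeff hj0.ne', if_neg hj0.ne', add_zero]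
    exact div_le_self (Nat.cast_nonneg _) (by exact_mod_cast hj0)

lemma sum_choose_eq_two_pow (K : ℕ) : ∑ j ∈ Finset.range (K + 1), (K.choose j : ℝ) = 2 ^ K := by
  exact_mod_cast Nat.sum_range_choose K

lemma scale_le (hε : 0 < ε) (h : ε < Δ) : scale Δ ε ≤ 4 * (Δ / ε) := by
  have h1 : scale Δ ε ≤ 2 ^ truncOrder Δ ε + truncOrder Δ ε := by
    refine (Finset.sum_le_sum fun j _ => abs_logCoeff_le _ j).trans ?_
    rw [Finset.sum_add_distrib, sum_choose_eq_two_pow]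
    simp
  have h2 : (truncOrder Δ ε : ℝ) ≤ 2 ^ truncOrder Δ ε := by
    exact_mod_cast (Nat.lt_two_pow_self (n := truncOrder Δ ε)).le
  have h3 := two_pow_truncOrder_le hε h
  linarith

lemma two_pow_div_le_scale (hε : 0 < ε) (h : ε < Δ) :
    2 ^ truncOrder Δ ε / (truncOrder Δ ε : ℝ) ≤ scale Δ ε := by
  rw [← sum_choose_eq_two_pow, Finset.sum_div]
  exact Finset.sum_le_sum fun j hj => choose_div_le_abs_logCoeff (truncOrder_pos hε h)
    (Nat.lt_succ_iff.1 (Finset.mem_range.1 hj))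

lemma one_le_scale (hε : 0 < ε) (h : ε < Δ) : 1 ≤ scale Δ ε := by
  refine le_trans ?_ (two_pow_div_le_scale hε h)
  rw [one_le_div (by exact_mod_cast truncOrder_pos hε h)]
  exact_mod_cast (Nat.lt_two_pow_self (n := truncOrder Δ ε)).le

/-- From `Λ ≥ 2^K / K` and `K² ≤ 2 · 2^K` one gets `2 Λ² ≥ 2^K ≥ Δ / ε`. This is what makes an error
of order `1 / Λ²` acceptable. -/
lemma div_le_two_mul_scale_sq (hε : 0 < ε) (h : ε < Δ) : Δ / ε ≤ 2 * scale Δ ε ^ 2 := by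
  have hK : (0 : ℝ) < truncOrder Δ ε := by exact_mod_cast truncOrder_pos hε h
  have h1 := two_pow_div_le_scale hε h
  have h2 := pow_le_pow_left₀ (by positivity) h1 2
  have h3 : (truncOrder Δ ε : ℝ) ^ 2 ≤ 2 * 2 ^ truncOrder Δ ε := by
    exact_mod_cast sq_le_two_mul_two_pow (truncOrder Δ ε)
  have h4 : (2 : ℝ) ^ truncOrder Δ ε ≤ 2 * (2 ^ truncOrder Δ ε / (truncOrder Δ ε : ℝ)) ^ 2 := by
    rw [div_pow, ← mul_div_assoc, le_div_iff₀ (by positivity)]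
    have h5 : (0 : ℝ) < 2 ^ truncOrder Δ ε := by positivity
    nlinarith
  linarith [div_le_two_pow_truncOrder hε h]

end Scale

/-! ### Error analysis of the two preparations. -/

section Attempts

variable {n : ℕ}

/-- The vector `|a⟩|0⟩ + |b⟩|1⟩`. -/
def glue {ι : Type} (a b : ι → ℂ) : ι × Fin 2 → ℂ := fun p => if p.2 = 0 then a p.1 else b p.1

lemma glue_sub {ι : Type} (a b a' b' : ι → ℂ) :
    glue a b - glue a' b' = glue (a - a') (b - b') := by
  ext p
  simp only [glue, Pi.sub_apply]
  split_ifs <;> rfl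

lemma glue_smul {ι : Type} (c : ℂ) (a b : ι → ℂ) : glue (c • a) (c • b) = c • glue a b := by
  ext p
  simp only [glue, Pi.smul_apply]
  split_ifs <;> rfl

lemma vecNorm_glue_sq {ι : Type} [Fintype ι] (a b : ι → ℂ) :
    vecNorm (glue a b) ^ 2 = vecNorm a ^ 2 + vecNorm b ^ 2 := by
  rw [vecNorm_sq, vecNorm_sq, vecNorm_sq, Fintype.sum_prod_type, ← Finset.sum_add_distrib]
  simp [glue, Fin.sum_univ_two]

lemma vecNorm_glue_choiVec (A : Matrix (Bits n) (Bits n) ℂ) :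
    vecNorm (glue (Complex.I • choiVec (tracelessPart A)) ((A.trace / 2 ^ n) • omega n))
      = vecNorm (choiVec A) := by
  rw [← sq_eq_sq₀ (vecNorm_nonneg _) (vecNorm_nonneg _), vecNorm_glue_sq, vecNorm_choiVec_sq A,
    vecNorm_smul, vecNorm_smul, vecNorm_omega, Complex.norm_I, one_mul, mul_one, add_comm]

/-- The evolution `U` is unitary, so the squared norm is `tr(U* U) / 2^n = 1`. -/
lemma vecNorm_choiVec_evolution {H : Matrix (Bits n) (Bits n) ℂ} (hH : H.IsHermitian) (t : ℝ) :
    vecNorm (choiVec (evolution H t)) = 1 := by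
  have h0 : ((-(Complex.I * (t : ℂ))) • H).conjTranspose = -((-(Complex.I * (t : ℂ))) • H) := by
    rw [Matrix.conjTranspose_smul, hH.eq, ← neg_smul]
    simp
  have h1 : (evolution H t).conjTranspose * evolution H t = 1 := by
    unfold evolution
    rw [← Matrix.exp_conjTranspose, h0,
      ← Matrix.exp_add_of_commute _ _ (Commute.refl ((-(Complex.I * (t : ℂ))) • H)).neg_left,
      neg_add_cancel, NormedSpace.exp_zero]
  have h2 := inner_choiVec (evolution H t) (evolution H t)
  have h3 := trace_ketbra (choiVec (evolution H t))
  have h4 : (ketbra (choiVec (evolution H t))).trace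
      = star (choiVec (evolution H t)) ⬝ᵥ choiVec (evolution H t) := by
    rw [ketbra, Matrix.trace_vecMulVec, dotProduct_comm]
  rw [h4, h2, h1, Matrix.trace_one] at h3
  have h5 : vecNorm (choiVec (evolution H t)) ^ 2 = 1 := by
    have : ((vecNorm (choiVec (evolution H t)) ^ 2 : ℝ) : ℂ) = 1 := by
      rw [← h3]
      simp
    exact_mod_cast this
  exact (pow_eq_one_iff_of_nonneg (vecNorm_nonneg _) two_ne_zero).1 h5

lemma isHermitian_tracelessPart {H : Matrix (Bits n) (Bits n) ℂ} (hH : H.IsHermitian) :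
    (tracelessPart H).IsHermitian := by
  have h1 : star H.trace = H.trace := by rw [← Matrix.trace_conjTranspose, hH.eq]
  rw [Matrix.IsHermitian, tracelessPart, Matrix.conjTranspose_sub, hH.eq, Matrix.conjTranspose_smul,
    Matrix.conjTranspose_one, star_div₀, h1]
  simp

/-- The last qubit of a register of `n + 1` qubits, split off. -/
def lastQubitEquiv (n : ℕ) : Bits (n + 1) ≃ Bits n × Fin 2 :=
  (Fin.snocEquiv fun _ => Fin 2).symm.trans (Equiv.prodComm _ _)

/-- The output register of a preparation attempt with reference. -/
def refRegEquiv (n : ℕ) : Bits n × Bits (n + 1) ≃ (Bits n × Bits n) × Fin 2 :=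
  ((Equiv.refl _).prodCongr (lastQubitEquiv n)).trans (Equiv.prodAssoc _ _ _).symm

lemma psiRef_eq (A : Matrix (Bits n) (Bits n) ℂ) :
    psiRef A = normalize fun x => glue (choiVec A) (omega n) (refRegEquiv n x) := rfl

/-- On input `|Ω⟩|0⟩`, a single query for a short time `t` followed by `separator` prepares the
pseudo-Choi state with reference of `t • H₀`, up to an error of second order in `t`. No flag qubit
is needed. -/
lemma exists_attempt_with_reference (n : ℕ) {t : ℝ} (ht : 0 ≤ t) :
    ∃ A : Protocol n (n + 1) 0, (∀ i, (A.circuit i).totalTime = t) ∧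
      (∀ i, ∀ s ∈ (A.circuit i).steps, s.time = t) ∧
      ∀ H : Matrix (Bits n) (Bits n) ℂ, H.IsHermitian → t * (2 * opNorm H) ≤ 1 →
        A.successProb H = 1 ∧
        traceDist (A.output H) (ketbra (psiRef (t • tracelessPart H)))
          ≤ 4 * (t * (2 * opNorm H)) ^ 2 := by
  obtain ⟨c, hc1, hc2, hc⟩ :=
    -- There are no flags: the qubit moved by `separator` is the last kept one, the reference.
    exists_circuit ((Equiv.prodUnique (Bits (n + 1)) (Bits 0)).trans (lastQubitEquiv n)) ht
  refine ⟨Protocol.ofCircuit c, fun _ => hc1, fun _ => hc2, fun H hH hsmall => ?_⟩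
  obtain ⟨u, hu, hev⟩ := exists_evolution_eq_smul_tracelessPart hH t
  set E := evolution (tracelessPart H) t with hE
  set v := glue (Complex.I • choiVec (tracelessPart E)) ((E.trace / 2 ^ n) • omega n) with hv
  have hflag : c.flagged H = u • fun x => v (refRegEquiv n x) := by
    have h1 : u • v = glue (Complex.I • choiVec (tracelessPart (u • E)))
        (((u • E).trace / 2 ^ n) • omega n) := by
      rw [hv, ← glue_smul, tracelessPart_smul, choiVec_smul, smul_comm, Matrix.trace_smul,
        smul_eq_mul, mul_div_assoc, mul_smul]
    have h2 : c.flagged H = fun x => (u • v) (refRegEquiv n x) := by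
      ext x
      rw [hc H x, hev, h1]
      rfl
    rw [h2]
    rfl
  have hvn : vecNorm (fun x => v (refRegEquiv n x)) = 1 := by
    rw [vecNorm_comp_equiv, hv, vecNorm_glue_choiVec,
      vecNorm_choiVec_evolution (isHermitian_tracelessPart hH)]
  refine ⟨by rw [Protocol.successProb_ofCircuit, hflag, vecNorm_smul, hu, hvn]; norm_num, ?_⟩
  have hop : t * opNorm (tracelessPart H) ≤ t * (2 * opNorm H) :=
    mul_le_mul_of_nonneg_left (opNorm_tracelessPart_le H) ht
  have hop0 : 0 ≤ t * opNorm (tracelessPart H) := mul_nonneg ht (opNorm_nonneg _)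
  obtain ⟨R, hR, hRn⟩ := exists_evolution_eq_add_remainder (tracelessPart H) ht (hop.trans hsmall)
  rw [← hE] at hR
  have htl : tracelessPart E = (-(Complex.I * (t : ℂ))) • tracelessPart H + tracelessPart R := by
    rw [hR, tracelessPart_add, tracelessPart_add, tracelessPart_one, zero_add, tracelessPart_smul,
      tracelessPart_tracelessPart]
  have htr : E.trace / 2 ^ n = 1 + R.trace / 2 ^ n := by
    rw [hR, Matrix.trace_add, Matrix.trace_add, Matrix.trace_smul, trace_tracelessPart, smul_zero,
      add_zero, add_div, Matrix.trace_one]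
    simp
  -- Since `i · (-i t) = t`, zeroth and first order cancel against the target, leaving only `R`
  -- split into trace and traceless part.
  have hdiff : v - glue (choiVec (t • tracelessPart H)) (omega n)
      = glue (Complex.I • choiVec (tracelessPart R)) ((R.trace / 2 ^ n) • omega n) := by
    have h1 : t • tracelessPart H = (t : ℂ) • tracelessPart H := rfl
    rw [hv, glue_sub, htl, htr, h1, choiVec_add, choiVec_smul, choiVec_smul, smul_add, smul_smul,
      add_smul, one_smul, add_sub_cancel_left]
    congr 1
    have h2 : Complex.I * -(Complex.I * (t : ℂ)) = t := by
      linear_combination -(t : ℂ) * Complex.I_mul_I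
    rw [h2, add_sub_cancel_left]
  rw [Protocol.output_ofCircuit, hflag, normalize_smul_of_norm_eq_one hu,
    ketbra_smul_of_norm_eq_one hu, psiRef_eq]
  refine (traceDist_ketbra_normalize_le _ _ (by rw [hvn]; exact one_pos)).trans ?_
  rw [hvn, div_one]
  have h1 : vecNorm ((fun x => v (refRegEquiv n x))
      - fun x => glue (choiVec (t • tracelessPart H)) (omega n) (refRegEquiv n x))
      = vecNorm (choiVec R) := by
    -- By Pythagoras the two pieces of the remainder reassemble to the norm of `choiVec R`.
    rw [← vecNorm_glue_choiVec, ← hdiff]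
    exact vecNorm_comp_equiv (refRegEquiv n) (v - glue (choiVec (t • tracelessPart H)) (omega n))
  rw [h1, sq]
  have h2 : t * vecNorm (choiVec (tracelessPart H)) ≤ t * opNorm (tracelessPart H) :=
    mul_le_mul_of_nonneg_left (vecNorm_choiVec_le _) ht
  refine mul_le_mul_of_nonneg_left (hRn.trans ?_) (by norm_num)
  exact mul_le_mul hop (h2.trans hop) (mul_nonneg ht (vecNorm_nonneg _)) (hop0.trans hop)

/-- If the last qubit of the circuit of `exists_circuit` is a flag, then success projects onto the
complement of `|Ω⟩`, which leaves the pseudo-Choi vector of `t • H₀` up to a relative error of first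
order in `t`. -/
lemma exists_attempt_without_reference (n : ℕ) {t : ℝ} (ht : 0 < t) :
    ∃ A : Protocol n n 1, (∀ i, (A.circuit i).totalTime = t) ∧
      (∀ i, ∀ s ∈ (A.circuit i).steps, s.time = t) ∧
      ∀ H : Matrix (Bits n) (Bits n) ℂ, H.IsHermitian → t * (2 * opNorm H) ≤ 1 / 2 →
        (t * ‖pauliParams H‖ / 2) ^ 2 ≤ A.successProb H ∧
        (tracelessPart H ≠ 0 →
          traceDist (A.output H) (ketbra (psi (tracelessPart H))) ≤ 8 * (t * (2 * opNorm H))) := by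
  obtain ⟨c, hc1, hc2, hc⟩ :=
    -- The qubit moved by `separator` is now the flag, so outcome 0 selects the traceless part.
    exists_circuit ((Equiv.refl (Bits n)).prodCongr (Equiv.funUnique (Fin 1) (Fin 2))) ht.le
  refine ⟨Protocol.ofCircuit c, fun _ => hc1, fun _ => hc2, fun H hH hsmall => ?_⟩
  obtain ⟨u, hu, hev⟩ := exists_evolution_eq_smul_tracelessPart hH t
  set E := evolution (tracelessPart H) t with hE
  have hflag : c.flagged H = u • Complex.I • choiVec (tracelessPart E) := by
    ext x
    rw [hc H x, hev, tracelessPart_smul, choiVec_smul]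
    exact mul_left_comm _ _ _
  set w := (t : ℂ) • choiVec (tracelessPart H) with hw
  have hwn : vecNorm w = t * vecNorm (choiVec (tracelessPart H)) := by
    rw [hw, vecNorm_smul, Complex.norm_real, Real.norm_of_nonneg ht.le]
  have hop : t * opNorm (tracelessPart H) ≤ t * (2 * opNorm H) :=
    mul_le_mul_of_nonneg_left (opNorm_tracelessPart_le H) ht.le
  obtain ⟨R, hR, hRn⟩ := exists_evolution_eq_add_remainder (tracelessPart H) ht.le
    (hop.trans (hsmall.trans (by norm_num)))
  rw [← hE] at hR
  have htl : tracelessPart E = (-(Complex.I * (t : ℂ))) • tracelessPart H + tracelessPart R := by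
    rw [hR, tracelessPart_add, tracelessPart_add, tracelessPart_one, zero_add, tracelessPart_smul,
      tracelessPart_tracelessPart]
  set v := Complex.I • choiVec (tracelessPart E) with hv
  have hdiff : v - w = Complex.I • choiVec (tracelessPart R) := by
    have h2 : Complex.I * -(Complex.I * (t : ℂ)) = t := by
      linear_combination -(t : ℂ) * Complex.I_mul_I
    rw [hv, hw, htl, choiVec_add, choiVec_smul, smul_add, smul_smul, h2, add_sub_cancel_left]
  have herr : vecNorm (v - w) ≤ t * (2 * opNorm H) * vecNorm w := by
    rw [hdiff, vecNorm_smul, Complex.norm_I, one_mul, hwn]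
    refine (vecNorm_choiVec_tracelessPart_le R).trans (hRn.trans ?_)
    exact mul_le_mul_of_nonneg_right hop (mul_nonneg ht.le (vecNorm_nonneg _))
  -- A relative error of at most `1 / 2` costs at most half of the amplitude.
  have hlow : vecNorm w / 2 ≤ vecNorm v := by
    have h1 := (abs_le.1 (abs_vecNorm_sub_vecNorm_le v w)).1
    have h2 := mul_le_mul_of_nonneg_right hsmall (vecNorm_nonneg w)
    linarith
  constructor
  · rw [Protocol.successProb_ofCircuit, hflag, vecNorm_smul, hu, one_mul]
    refine pow_le_pow_left₀ (by positivity) (le_trans ?_ hlow) 2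
    rw [hwn]
    have := mul_le_mul_of_nonneg_left (norm_pauliParams_le H) ht.le
    linarith
  · intro hne
    have hw0 : 0 < vecNorm w := by
      rw [hwn]
      refine mul_pos ht (lt_of_le_of_ne (vecNorm_nonneg _) fun h0 => hne ?_)
      -- The Choi vector determines the operator, so it cannot vanish when `H₀ ≠ 0`.
      ext x y
      have h1 := congrFun (vecNorm_eq_zero.1 h0.symm) (x, y)
      rw [choiVec_apply] at h1
      have h2 : ((1 / Real.sqrt (2 ^ n) : ℝ) : ℂ) ≠ 0 := by
        rw [Complex.ofReal_ne_zero]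
        positivity
      exact (mul_eq_zero.1 h1).resolve_right h2
    have hv0 : 0 < vecNorm v := lt_of_lt_of_le (half_pos hw0) hlow
    rw [Protocol.output_ofCircuit, hflag, normalize_smul_of_norm_eq_one hu,
      ketbra_smul_of_norm_eq_one hu, psi,
      ← normalize_smul_of_pos ht (choiVec (tracelessPart H))]
    refine (traceDist_ketbra_normalize_le _ _ hv0).trans ?_
    rw [div_le_iff₀ hv0]
    have h3 : 0 ≤ t * (2 * opNorm H) := by
      have := opNorm_nonneg H
      positivity
    have h4 := mul_le_mul_of_nonneg_left hlow h3
    linarith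

end Attempts

end PseudoChoi

end

/-! ### Choice of evolution times and constants. -/

theorem theorem5 :
    ∃ C : ℝ, 0 < C ∧ ∃ c : ℝ, 0 < c ∧ ∃ p : ℕ, ∀ (n : ℕ) (Δ ε : ℝ), 0 < ε → ε < Δ →
      PseudoChoi.scale Δ ε ≤ C * (Δ / ε) ∧
      (∃ (q : ℕ) (A : PseudoChoi.Protocol n (n + 1) q),
        A.TotalTimeLE (C * (1 / Δ) * (1 + Real.log (Δ / ε)) ^ 2) ∧
        A.ResolutionGE (c * (ε / Δ ^ 2) / (1 + Real.log (Δ / ε)) ^ p) ∧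
        (A.numAncilla : ℝ) ≤ n + C * (1 + Real.log (1 + Real.log (Δ / ε))) ∧
        ∀ H : Matrix (PseudoChoi.Bits n) (PseudoChoi.Bits n) ℂ, H.IsHermitian →
          2 * PseudoChoi.opNorm H ≤ Δ →
          1 / 2 ≤ A.successProb H ∧
          PseudoChoi.traceDist (A.output H)
            (PseudoChoi.ketbra (PseudoChoi.psiRef
              ((1 / (PseudoChoi.scale Δ ε * Δ) : ℝ) • PseudoChoi.tracelessPart H)))
            ≤ C * (ε / Δ)) ∧
      (∃ (q : ℕ) (A : PseudoChoi.Protocol n n q),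
        A.TotalTimeLE (C * (1 / Δ) * (1 + Real.log (Δ / ε)) ^ 2) ∧
        A.ResolutionGE (c * (ε / Δ ^ 2) / (1 + Real.log (Δ / ε)) ^ p) ∧
        (A.numAncilla : ℝ) ≤ n + C * (1 + Real.log (1 + Real.log (Δ / ε))) ∧
        ∀ H : Matrix (PseudoChoi.Bits n) (PseudoChoi.Bits n) ℂ, H.IsHermitian →
          2 * PseudoChoi.opNorm H ≤ Δ →
          c * (ε ^ 2 * ‖(1 / Δ ^ 2 : ℝ) • PseudoChoi.pauliParams H‖ ^ 2) ≤ A.successProb H ∧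
          (PseudoChoi.tracelessPart H ≠ 0 →
            PseudoChoi.traceDist (A.output H)
              (PseudoChoi.ketbra (PseudoChoi.psi (PseudoChoi.tracelessPart H)))
              ≤ C * (ε / Δ))) := by
  -- `8 = 4 · 2` comes from the error `4 / Λ² ≤ 8 ε / Δ` with reference, and `1 / 16` from `(t /
  -- 2)²` at `t = ε / (2 Δ²)`. The resolution needs no logarithmic loss, so `p = 0`.
  refine ⟨8, by norm_num, 1 / 16, by norm_num, 0, fun n Δ ε hε hεΔ => ?_⟩
  have hΔ : 0 < Δ := hε.trans hεΔ
  have hΛ := PseudoChoi.one_le_scale hε hεΔ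
  have hΛ4 := PseudoChoi.scale_le hε hεΔ
  have hΛ2 := PseudoChoi.div_le_two_mul_scale_sq hε hεΔ
  have hΛ0 : 0 < PseudoChoi.scale Δ ε := one_pos.trans_le hΛ
  have hlog : 0 ≤ Real.log (Δ / ε) := Real.log_nonneg ((one_le_div hε).2 hεΔ.le)
  have hloglog : 0 ≤ Real.log (1 + Real.log (Δ / ε)) := Real.log_nonneg (by linarith)
  have htime : 1 / Δ ≤ 8 * (1 / Δ) * (1 + Real.log (Δ / ε)) ^ 2 := by
    have h1 : 1 ≤ (1 + Real.log (Δ / ε)) ^ 2 := one_le_pow₀ (by linarith)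
    have h2 : 0 < 1 / Δ := by positivity
    nlinarith
  refine ⟨hΛ4.trans (by gcongr; norm_num), ?_, ?_⟩
  · have ht : 0 ≤ 1 / (PseudoChoi.scale Δ ε * Δ) := by positivity
    obtain ⟨A, hA1, hA2, hA3⟩ := PseudoChoi.exists_attempt_with_reference n ht
    refine ⟨0, A, fun i => ?_, fun i s hs => ?_, ?_, fun H hH hop => ?_⟩
    · rw [hA1 i]
      refine le_trans ?_ htime
      gcongr
      exact le_mul_of_one_le_left hΔ.le hΛ
    · rw [hA2 i s hs, pow_zero, div_one, le_div_iff₀ (by positivity)]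
      -- The upper bound on `Λ` keeps the single query time from being too short.
      calc 1 / 16 * (ε / Δ ^ 2) * (PseudoChoi.scale Δ ε * Δ)
          ≤ 1 / 16 * (ε / Δ ^ 2) * (4 * (Δ / ε) * Δ) := by gcongr
        _ = 1 / 4 := by field_simp; norm_num
        _ ≤ 1 := by norm_num
    · simp only [PseudoChoi.Protocol.numAncilla]
      push_cast
      linarith
    · have hsmall : 1 / (PseudoChoi.scale Δ ε * Δ) * (2 * PseudoChoi.opNorm H)
          ≤ 1 / PseudoChoi.scale Δ ε := by
        calc _ ≤ 1 / (PseudoChoi.scale Δ ε * Δ) * Δ := by gcongr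
          _ = _ := by field_simp
      obtain ⟨h1, h2⟩ := hA3 H hH (hsmall.trans ((div_le_one hΛ0).2 hΛ))
      refine ⟨by rw [h1]; norm_num, h2.trans ?_⟩
      have h0 : 0 ≤ 1 / (PseudoChoi.scale Δ ε * Δ) * (2 * PseudoChoi.opNorm H) :=
        mul_nonneg ht (mul_nonneg zero_le_two (PseudoChoi.opNorm_nonneg H))
      have h3 := pow_le_pow_left₀ h0 hsmall 2
      have h4 : (1 / PseudoChoi.scale Δ ε) ^ 2 ≤ 2 * (ε / Δ) := by
        rw [div_pow, one_pow, div_le_iff₀ (by positivity)]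
        calc (1 : ℝ) = ε / Δ * (Δ / ε) := by field_simp
          _ ≤ ε / Δ * (2 * PseudoChoi.scale Δ ε ^ 2) := by gcongr
          _ = _ := by ring
      linarith
  -- This time makes the relative error `t · 2‖H‖` at most `ε / (2 Δ)`, hence at most `1 / 2`.
  · have ht : 0 < ε / (2 * Δ ^ 2) := by positivity
    have hratio : ε / Δ ≤ 1 := (div_le_one hΔ).2 hεΔ.le
    have htΔ : ε / (2 * Δ ^ 2) * Δ = ε / Δ / 2 := by field_simp
    obtain ⟨A, hA1, hA2, hA3⟩ := PseudoChoi.exists_attempt_without_reference n ht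
    refine ⟨1, A, fun i => ?_, fun i s hs => ?_, ?_, fun H hH hop => ?_⟩
    · rw [hA1 i]
      refine le_trans ?_ htime
      rw [le_div_iff₀ hΔ, htΔ]
      linarith
    · rw [hA2 i s hs, pow_zero, div_one]
      have : ε / (2 * Δ ^ 2) = 1 / 2 * (ε / Δ ^ 2) := by field_simp
      rw [this]
      gcongr
      norm_num
    · simp only [PseudoChoi.Protocol.numAncilla]
      push_cast
      linarith
    · have hsmall : ε / (2 * Δ ^ 2) * (2 * PseudoChoi.opNorm H) ≤ ε / Δ / 2 := by
        rw [← htΔ]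
        gcongr
      obtain ⟨h1, h2⟩ := hA3 H hH (by linarith)
      refine ⟨le_trans (le_of_eq ?_) h1, fun hne => (h2 hne).trans ?_⟩
      · rw [norm_smul, Real.norm_of_nonneg (by positivity)]
        field_simp
        ring
      · have : 0 < ε / Δ := by positivity
        linarith
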